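/- Let $\mathbb H$ be a separable real or complex Hilbert space and let $\mathcal H,\hat{\mathcal H}$ be compact self-adjoint operators on $\mathbb H$. Fix an orthonormal basis $(\psi_k)$ of $\mathbb H$ consisting of eigenvectors of $\mathcal H$, $\mathcal H\psi_k=\lambda_k\psi_k$, and likewise an orthonormal basis $(\hat\psi_k)$ with $\hat{\mathcal H}\hat\psi_k=\hat\lambda_k\hat\psi_k$, so that eigenvalues are repeated according to multiplicity. They are indexed as follows. If $\dim\mathbb H=d<\infty$, then $k=1,\dots,d$ and $\lambda_1\ge\dots\ge\lambda_d$. If $\dim\mathbb H=\infty$, the eigenvalues are arranged as $\lambda_1\ge\lambda_2\ge\dots\ge0\ge\dots\ge\lambda_{-2}\ge\lambda_{-1}$ (either list may be finite, infinite or empty), and those basis vectors that are reached by neither list lie in the kernel and carry extra indices with eigenvalue $0$; if all eigenvalues are non-negative, this is the usual list $\lambda_1\ge\lambda_2\ge\dots\ge0$, completed by a basis of the unlisted part of the kernel. The same conventions apply to $\hat{\mathcal H}$. Write $\mathcal Q_k v=\langle \psi_k,v\rangle\psi_k$ (inner product linear in the second argument) and $\hat{\mathcal Q}_k v=\langle\hat\psi_k,v\rangle\hat\psi_k$.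 Let $\mathcal J$ be a finite set of indices of $\mathcal H$ whose outer gap is positive: $$\gamma_{\mathcal J}:=\inf_{k\in\mathcal J,\ \ell\notin\mathcal J}|\lambda_k-\lambda_\ell|>0,$$ where $\mathcal J$ and its complement in the set of indices of $\mathcal H$ are non-empty and $\ell$ runs over that complement. Let $K$ be the number of distinct values in $\{\lambda_k:k\in\mathcal J\}$, and put $\mathcal P_{\mathcal J}=\sum_{k\in\mathcal J}\mathcal Q_k$ and $\hat{\mathcal P}_{\mathcal J}=\sum_{k\in\mathcal J}\hat{\mathcal Q}_k$. If, in operator norm, $$\frac{\|\hat{\mathcal H}-\mathcal H\|}{\gamma_{\mathcal J}}<\frac14,$$ then every $k\in\mathcal J$ is also an index of $\hat{\mathcal H}$ (so that $\hat{\mathcal P}_{\mathcal J}$ is defined), the series over $\ell$ in $$\hat{\mathcal S}_{\mathcal J}=\sum_{k\in\mathcal J}\sum_{\ell\notin\mathcal J}\frac{\mathcal Q_k(\hat{\mathcal H}-\mathcal H)\mathcal Q_\ell+\mathcal Q_\ell(\hat{\mathcal H}-\mathcal H)\mathcal Q_k}{\lambda_k-\lambda_\ell}$$ converge unconditionally in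 operator norm, and $$\bigl\|\hat{\mathcal P}_{\mathcal J}-\mathcal P_{\mathcal J}-\hat{\mathcal S}_{\mathcal J}\bigr\|\le 8K\left(\frac{\|\hat{\mathcal H}-\mathcal H\|}{\gamma_{\mathcal J}}\right)^2 .$$ -/

import Mathlib

/-- Indices of the eigenpairs of a compact self-adjoint operator, counted from zero.
`top k` is the `(k+1)`-st eigenpair from the top, `bot k` is the `(k+1)`-st eigenpair from the
bottom, and `ker k` labels further eigenvectors of the eigenvalue `0`, which an enumeration
from the top or from the bottom alone need not reach. -/
inductive EigenIndex : Type
  | top (k : ℕ) : EigenIndex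
  | ker (k : ℕ) : EigenIndex
  | bot (k : ℕ) : EigenIndex

section

variable {𝕜 : Type*} [RCLike 𝕜] {E : Type*} [NormedAddCommGroup E] [InnerProductSpace 𝕜 E]

/-- A complete orthonormal system of eigenvectors of `T`, with the eigenvalues repeated according
to multiplicity and arranged in order.

In finite dimension `d` this is a list `λ₁ ≥ ⋯ ≥ λ_d` of all eigenvalues. In infinite dimension it
is an arrangement `λ₁ ≥ λ₂ ≥ ⋯ ≥ 0 ≥ ⋯ ≥ λ₋₂ ≥ λ₋₁` together with the part of an orthonormal basis
of the kernel that is not listed yet (for instance when infinitely many eigenvalues are positive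
and the kernel is nonzero). Each of the three lists may be finite, infinite or empty. -/
structure EigenSystem (T : E →L[𝕜] E) where
  /-- the indices in use -/
  indices : Set EigenIndex
  /-- the eigenvalues; only the values on `indices` matter -/
  val : EigenIndex → ℝ
  /-- the eigenvectors; only the values on `indices` matter -/
  vec : EigenIndex → E
  orthonormal : Orthonormal 𝕜 (fun i : indices => vec i)
  complete : (Submodule.span 𝕜 (vec '' indices)).topologicalClosure = ⊤
  apply_vec : ∀ i ∈ indices, T (vec i) = (val i : 𝕜) • vec i
  top_succ : ∀ k, EigenIndex.top (k + 1) ∈ indices →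
    EigenIndex.top k ∈ indices ∧ val (EigenIndex.top (k + 1)) ≤ val (EigenIndex.top k)
  bot_succ : ∀ k, EigenIndex.bot (k + 1) ∈ indices →
    EigenIndex.bot k ∈ indices ∧ val (EigenIndex.bot k) ≤ val (EigenIndex.bot (k + 1))
  top_of_finite : FiniteDimensional 𝕜 E → ∀ i ∈ indices, ∃ k, i = EigenIndex.top k
  top_nonneg : ¬ FiniteDimensional 𝕜 E →
    ∀ k, EigenIndex.top k ∈ indices → 0 ≤ val (EigenIndex.top k)
  ker_eq_zero : ¬ FiniteDimensional 𝕜 E →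
    ∀ k, EigenIndex.ker k ∈ indices → val (EigenIndex.ker k) = 0
  bot_nonpos : ¬ FiniteDimensional 𝕜 E →
    ∀ k, EigenIndex.bot k ∈ indices → val (EigenIndex.bot k) ≤ 0

namespace EigenSystem

variable {T : E →L[𝕜] E}

/-- The rank-one eigenprojection `Q_i = ψ_i ⊗ ψ_i`, that is `v ↦ ⟪ψ_i, v⟫ ψ_i`. -/
noncomputable def Q (D : EigenSystem T) (i : EigenIndex) : E →L[𝕜] E :=
  InnerProductSpace.rankOne 𝕜 (D.vec i) (D.vec i)

/-- The eigenprojection `P_J = ∑_{k ∈ J} Q_k`. -/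
noncomputable def P (D : EigenSystem T) (J : Finset EigenIndex) : E →L[𝕜] E :=
  ∑ k ∈ J, D.Q k

/-- The outer gap `γ_J`, the infimum of `|λ_k - λ_ℓ|` over `k ∈ J` and the indices `ℓ ∉ J`. -/
noncomputable def gap (D : EigenSystem T) (J : Finset EigenIndex) : ℝ :=
  sInf {r : ℝ | ∃ k ∈ J, ∃ l ∈ D.indices, l ∉ J ∧ r = |D.val k - D.val l|}

/-- The number `K` of distinct eigenvalues among the `λ_k`, `k ∈ J`. -/
noncomputable def numDistinct (D : EigenSystem T) (J : Finset EigenIndex) : ℕ :=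
  (D.val '' (J : Set EigenIndex)).ncard

/-- The summand `(Q_k A Q_ℓ + Q_ℓ A Q_k) / (λ_k - λ_ℓ)` of the first-order term for the
perturbation `A`. -/
noncomputable def firstOrderSummand (D : EigenSystem T) (A : E →L[𝕜] E) (k l : EigenIndex) :
    E →L[𝕜] E :=
  (((D.val k - D.val l)⁻¹ : ℝ) : 𝕜) •
    (D.Q k ∘L A ∘L D.Q l + D.Q l ∘L A ∘L D.Q k)

/-- The first-order term
`S_J = ∑_{k ∈ J} ∑_{ℓ ∉ J} (Q_k A Q_ℓ + Q_ℓ A Q_k) / (λ_k - λ_ℓ)`;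
the inner sums are in the operator norm. -/
noncomputable def firstOrder (D : EigenSystem T) (A : E →L[𝕜] E) (J : Finset EigenIndex) :
    E →L[𝕜] E :=
  ∑ k ∈ J, ∑' l : {l : EigenIndex // l ∈ D.indices ∧ l ∉ J}, D.firstOrderSummand A k l

end EigenSystem

end

/-!
The proof compares the blocks of `X = P'_J - P_J - S_J` with respect to the projection `P = P_J`.
Write `A = H' - H`, `δ = ‖A‖` and `γ = γ_J`.

*Eigenvalues.* By min-max (`HilbertBasis.le_add_norm_sub_of_card_lt`) the lists counted from the top
and from the bottom satisfy Weyl's inequality, where in infinite dimension a missing entry counts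
as `0` (`EigenSystem.abs_extVal_sub_le`). In infinite dimension compactness puts eigenvalues outside
the finite set `J` arbitrarily close to `0`, hence `|λ_k| ≥ γ` for `k ∈ J`
(`EigenSystem.le_abs_val_of_gap`). So the indices in `J` remain in use for `H'`, their eigenvalues
move by at most `δ`, and all other eigenvalues of `H'` have distance at least `γ - δ` from the
unperturbed eigenvalues in `J` (`EigenSystem.perturbed_eigenvalues`).

*Blocks.* For one value `μ` of the eigenvalues in `J`, the operator `H - μ` is bounded below by `γ`
on the range of `1 - P`, and `H' - μ` by `γ - δ` on the range of `1 - P'`. Applying these operators to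
the parts of `(1 - P') P`, `(1 - P) P'` and `(1 - P) X P` that belong to `μ` gives commutator
identities with right sides of order `δ`, `δ` and `δ²`. The `K` spectral subspaces are
orthogonal, so combining them costs only a factor `√K`
(`EigenSystem.norm_mul_P_le_sqrt_card`). This bounds the first two operators by `4/3 √K δ/γ`, and
hence the off-diagonal blocks of `X` by `8/3 K (δ/γ)²`. The first-order term has no diagonal blocks,
so those of `X` are `-((1 - P') P)⋆ (1 - P') P` and `(1 - P) P' ((1 - P) P')⋆`, which are bounded by
`16/9 K (δ/γ)²`. Altogether `‖X‖ ≤ 16/3 K (δ/γ)²`.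
-/

/-! ### Self-adjoint operators in a Hilbert basis of eigenvectors -/

section HilbertBasisLemmas

variable {𝕜 : Type*} [RCLike 𝕜] {E : Type*} [NormedAddCommGroup E] [InnerProductSpace 𝕜 E]
  {ι ι' : Type*}

theorem HilbertBasis.hasSum_norm_inner_sq (b : HilbertBasis ι 𝕜 E) (x : E) :
    HasSum (fun i => ‖inner 𝕜 (b i) x‖ ^ 2) (‖x‖ ^ 2) := by
  have h := (RCLike.hasSum_re 𝕜 (b.hasSum_inner_mul_inner x x))
  rw [inner_self_eq_norm_sq] at h
  convert h using 2 with i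
  rw [inner_mul_symm_re_eq_norm, norm_mul, norm_inner_symm x, sq]

theorem HilbertBasis.norm_le_norm_of_norm_inner_le (b : HilbertBasis ι 𝕜 E) {x y : E}
    (h : ∀ i, ‖inner 𝕜 (b i) x‖ ≤ ‖inner 𝕜 (b i) y‖) : ‖x‖ ≤ ‖y‖ := by
  have := hasSum_le (fun i => pow_le_pow_left₀ (norm_nonneg _) (h i) 2)
    (b.hasSum_norm_inner_sq x) (b.hasSum_norm_inner_sq y)
  exact le_of_sq_le_sq this (norm_nonneg _)

/-- A self-adjoint operator acts diagonally on the coordinates in a basis of eigenvectors. -/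
theorem IsSelfAdjoint.inner_eigenvector [CompleteSpace E] {T : E →L[𝕜] E} (hT : IsSelfAdjoint T)
    {v : E} {a : ℝ} (hv : T v = (a : 𝕜) • v) (x : E) :
    inner 𝕜 v (T x) = (a : 𝕜) * inner 𝕜 v x := by
  have h := hT.isSymmetric v x
  simp only [ContinuousLinearMap.coe_coe] at h
  rw [← h, hv, inner_smul_left, RCLike.conj_ofReal]

variable [CompleteSpace E]

theorem HilbertBasis.mul_norm_sq_le_re_inner (b : HilbertBasis ι 𝕜 E) {T : E →L[𝕜] E}
    (hT : IsSelfAdjoint T) {val : ι → ℝ} (hb : ∀ i, T (b i) = (val i : 𝕜) • b i) {a : ℝ} {x : E}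
    (h : ∀ i, inner 𝕜 (b i) x = 0 ∨ a ≤ val i) :
    a * ‖x‖ ^ 2 ≤ RCLike.re (inner 𝕜 x (T x)) := by
  have h1 := RCLike.hasSum_re 𝕜 (b.hasSum_inner_mul_inner x (T x))
  refine hasSum_le (fun i => ?_) ((b.hasSum_norm_inner_sq x).mul_left a) h1
  have h2 : inner 𝕜 x (b i) * inner 𝕜 (b i) (T x) = ((val i * ‖inner 𝕜 (b i) x‖ ^ 2 : ℝ) : 𝕜) := by
    rw [hT.inner_eigenvector (hb i), ← inner_conj_symm x (b i), mul_left_comm, RCLike.conj_mul]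
    push_cast; rfl
  rw [h2, RCLike.ofReal_re]
  rcases h i with h | h
  · simp [h]
  · gcongr

/-- The min-max comparison of two operators: if `H` has more eigenvalues that are at least `a`
than `H'` has eigenvalues that exceed `c`, then `a ≤ c + ‖H' - H‖`. Indeed some nonzero vector is
spanned by the first eigenvectors and orthogonal to the second ones. -/
theorem HilbertBasis.le_add_norm_sub_of_card_lt (b : HilbertBasis ι 𝕜 E)
    (b' : HilbertBasis ι' 𝕜 E) {H H' : E →L[𝕜] E} (hH : IsSelfAdjoint H) (hH' : IsSelfAdjoint H')
    {val : ι → ℝ} {val' : ι' → ℝ} (hb : ∀ i, H (b i) = (val i : 𝕜) • b i)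
    (hb' : ∀ i, H' (b' i) = (val' i : 𝕜) • b' i) (s : Finset ι) (s' : Finset ι')
    (hcard : s'.card < s.card) {a c : ℝ} (ha : ∀ i ∈ s, a ≤ val i) (hc : ∀ i ∉ s', val' i ≤ c) :
    a ≤ c + ‖H' - H‖ := by
  classical
  -- `g ∘ f` maps coefficients on `s` to the coordinates in `s'`, so its kernel is nonzero
  let f : (s → 𝕜) →ₗ[𝕜] E := Fintype.linearCombination 𝕜 (fun i : s => b i)
  let g : E →ₗ[𝕜] (s' → 𝕜) := LinearMap.pi fun i => (innerSL 𝕜 (b' i)).toLinearMap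
  obtain ⟨x, hx, hx0⟩ := Submodule.exists_mem_ne_zero_of_ne_bot
    (LinearMap.ker_ne_bot_of_finrank_lt (f := g ∘ₗ f) (by simpa using hcard))
  have hfx : f x = ∑ i : s, x i • b i := Fintype.linearCombination_apply _ _ _
  have hlin : LinearIndependent 𝕜 (fun i : s => b i) :=
    b.orthonormal.linearIndependent.comp _ Subtype.val_injective
  have hv0 : f x ≠ 0 := fun h0 => hx0 <| by
    have := Fintype.linearIndependent_iff.1 hlin x (hfx ▸ h0)
    exact funext this
  set v := f x with hv
  have hv1 : ∀ i ∉ s, inner 𝕜 (b i) v = 0 := by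
    intro i hi
    rw [hfx, inner_sum]
    refine Finset.sum_eq_zero fun j _ => ?_
    rw [inner_smul_right, b.orthonormal.inner_eq_zero (fun hij : i = j => hi (hij ▸ j.2)), mul_zero]
  have hv2 : ∀ i ∈ s', inner 𝕜 (b' i) v = 0 := fun i hi => congrFun (LinearMap.mem_ker.1 hx) ⟨i, hi⟩
  have h1 := b.mul_norm_sq_le_re_inner hH hb (a := a) (x := v) fun i =>
    (em (i ∈ s)).elim (fun h => .inr (ha i h)) (fun h => .inl (hv1 i h))
  have h2 := b'.mul_norm_sq_le_re_inner hH'.neg (val := fun i => -val' i) (a := -c) (x := v)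
    (fun i => by simp [hb']) fun i =>
    (em (i ∈ s')).elim (fun h => .inl (hv2 i h)) (fun h => .inr (neg_le_neg (hc i h)))
  have h3 : |RCLike.re (inner 𝕜 v ((H' - H) v))| ≤ ‖H' - H‖ * ‖v‖ ^ 2 := by
    calc _ ≤ ‖inner 𝕜 v ((H' - H) v)‖ := RCLike.abs_re_le_norm _
      _ ≤ ‖v‖ * ‖(H' - H) v‖ := norm_inner_le_norm _ _
      _ ≤ ‖v‖ * (‖H' - H‖ * ‖v‖) := by gcongr; exact ContinuousLinearMap.le_opNorm _ _
      _ = _ := by ring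
  simp only [neg_apply, inner_neg_right, map_neg] at h2
  simp only [sub_apply, inner_sub_right, map_sub] at h3
  have h4 := (abs_le.1 h3).1
  have h5 : 0 < ‖v‖ ^ 2 := by positivity
  refine le_of_mul_le_mul_right ?_ h5
  linarith

end HilbertBasisLemmas

/-- A compact operator has only finitely many orthonormal eigenvectors with eigenvalues bounded
away from `0`. -/
theorem Orthonormal.finite_le_norm_of_isCompactOperator
    {𝕜 : Type*} [RCLike 𝕜] {E : Type*} [NormedAddCommGroup E] [InnerProductSpace 𝕜 E]
    {ι : Type*} {v : ι → E} (hv : Orthonormal 𝕜 v) {T : E →L[𝕜] E} (hT : IsCompactOperator T)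
    {val : ι → ℝ} (h : ∀ i, T (v i) = (val i : 𝕜) • v i) {ε : ℝ} (hε : 0 < ε) :
    {i | ε ≤ |val i|}.Finite := by
  by_contra hinf
  obtain ⟨u, hu⟩ : ∃ u : ℕ → ι, Function.Injective u ∧ ∀ n, ε ≤ |val (u n)| :=
    ⟨fun n => (Set.Infinite.natEmbedding _ hinf n), fun m n hmn =>
      (Set.Infinite.natEmbedding _ hinf).injective (Subtype.ext hmn),
      fun n => (Set.Infinite.natEmbedding _ hinf n).2⟩
  have hK := hT.isCompact_closure_image_closedBall (1 : ℝ)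
  obtain ⟨y, -, φ, hφ, hlim⟩ := hK.tendsto_subseq (x := fun n => T (v (u n))) fun n =>
    subset_closure ⟨_, by simp [hv.1], rfl⟩
  obtain ⟨N, hN⟩ := Metric.cauchySeq_iff.1 hlim.cauchySeq ε hε
  have hlt := hN N le_rfl (N + 1) (Nat.le_succ N)
  set i := u (φ N) with hi
  set j := u (φ (N + 1)) with hj
  have hij : i ≠ j := fun hh => absurd (hφ.injective (hu.1 hh)) (by simp)
  have hne : inner 𝕜 (v i) (v j) = 0 := hv.2 hij
  -- by orthogonality the distance between the images is at least `|val i|`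
  have h1 : |val i| ≤ ‖T (v i) - T (v j)‖ := by
    have h2 : ‖inner 𝕜 (v i) (T (v i) - T (v j))‖ = |val i| := by
      rw [h, h, inner_sub_right, inner_smul_right, inner_smul_right, hne,
        inner_self_eq_norm_sq_to_K, hv.1]
      simp
    calc |val i| = _ := h2.symm
      _ ≤ ‖v i‖ * ‖T (v i) - T (v j)‖ := norm_inner_le_norm _ _
      _ = _ := by rw [hv.1, one_mul]
  rw [dist_eq_norm] at hlt
  exact absurd (hu.2 (φ N)) (not_le.2 (h1.trans_lt hlt))

/-! ### Finite spectral projections -/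

/-- Classical decidable equality, for the finite set operations on indices. -/
noncomputable instance EigenIndex.instDecidableEq : DecidableEq EigenIndex := Classical.decEq _

namespace EigenSystem

variable {𝕜 : Type*} [RCLike 𝕜] {E : Type*} [NormedAddCommGroup E] [InnerProductSpace 𝕜 E]
  {T : E →L[𝕜] E}

theorem inner_vec (D : EigenSystem T) {i j : EigenIndex} (hi : i ∈ D.indices)
    (hj : j ∈ D.indices) : inner 𝕜 (D.vec i) (D.vec j) = if i = j then 1 else 0 := by
  have := (orthonormal_iff_ite.1 D.orthonormal) ⟨i, hi⟩ ⟨j, hj⟩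
  simpa using this

theorem P_apply (D : EigenSystem T) (s : Finset EigenIndex) (x : E) :
    D.P s x = ∑ k ∈ s, inner 𝕜 (D.vec k) x • D.vec k := by
  simp [P, Q]

theorem sum_P_fiber (D : EigenSystem T) (J : Finset EigenIndex) (f : EigenIndex → ℝ) :
    ∑ μ ∈ J.image f, D.P {k ∈ J | f k = μ} = D.P J := by
  unfold P
  exact Finset.sum_fiberwise_of_maps_to (fun k hk => Finset.mem_image_of_mem f hk) _

theorem inner_P_apply (D : EigenSystem T) {s : Finset EigenIndex} (hs : (s : Set _) ⊆ D.indices)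
    {i : EigenIndex} (hi : i ∈ D.indices) (x : E) :
    inner 𝕜 (D.vec i) (D.P s x) = if i ∈ s then inner 𝕜 (D.vec i) x else 0 := by
  rw [P_apply, inner_sum]
  rw [Finset.sum_congr rfl fun k hk => by rw [inner_smul_right, D.inner_vec hi (hs hk)]]
  simp

variable [CompleteSpace E]

/-- The eigenvectors of an eigensystem as a Hilbert basis indexed by `D.indices`. -/
noncomputable def basis (D : EigenSystem T) : HilbertBasis D.indices 𝕜 E :=
  HilbertBasis.mk D.orthonormal <| by
    rw [← D.complete, Set.image_eq_range]

@[simp]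
theorem basis_apply (D : EigenSystem T) (i : D.indices) : D.basis i = D.vec i := by
  simp [basis]

theorem apply_basis (D : EigenSystem T) (i : D.indices) :
    T (D.basis i) = (D.val i : 𝕜) • D.basis i := by
  simpa using D.apply_vec i i.2

theorem isSelfAdjoint_P (D : EigenSystem T) (s : Finset EigenIndex) : IsSelfAdjoint (D.P s) := by
  refine isSelfAdjoint_sum _ fun k _ => ?_
  rw [ContinuousLinearMap.isSelfAdjoint_iff', Q, InnerProductSpace.adjoint_rankOne]

theorem ext_inner (D : EigenSystem T) {x y : E}
    (h : ∀ i ∈ D.indices, inner 𝕜 (D.vec i) x = inner 𝕜 (D.vec i) y) : x = y := by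
  refine sub_eq_zero.1 (norm_le_zero_iff.1 ?_)
  have := D.basis.norm_le_norm_of_norm_inner_le (x := x - y) (y := 0) fun i => by
    rw [basis_apply, inner_sub_right, h i i.2]; simp
  simpa using this

theorem P_mul_P (D : EigenSystem T) {s t : Finset EigenIndex} (hs : (s : Set _) ⊆ D.indices)
    (ht : (t : Set _) ⊆ D.indices) (hst : s ⊆ t) : D.P t * D.P s = D.P s := by
  ext x
  refine D.ext_inner fun i hi => ?_
  rw [mul_apply_eq_comp, D.inner_P_apply ht hi, D.inner_P_apply hs hi]
  split_ifs with h1 h2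
  · rfl
  · rfl
  · exact absurd (hst ‹_›) h1
  · rfl

theorem mul_P_eq_P_mul (D : EigenSystem T) (hT : IsSelfAdjoint T) {s : Finset EigenIndex}
    (hs : (s : Set _) ⊆ D.indices) : T * D.P s = D.P s * T := by
  ext x
  refine D.ext_inner fun i hi => ?_
  rw [mul_apply_eq_comp, mul_apply_eq_comp, D.inner_P_apply hs hi,
    hT.inner_eigenvector (D.apply_vec i hi), hT.inner_eigenvector (D.apply_vec i hi),
    D.inner_P_apply hs hi]
  split_ifs <;> simp

theorem norm_P_le_one (D : EigenSystem T) {s : Finset EigenIndex} (hs : (s : Set _) ⊆ D.indices) :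
    ‖D.P s‖ ≤ 1 := by
  refine ContinuousLinearMap.opNorm_le_bound _ zero_le_one fun x => ?_
  rw [one_mul]
  refine D.basis.norm_le_norm_of_norm_inner_le fun i => ?_
  rw [basis_apply, D.inner_P_apply hs i.2]
  split_ifs <;> simp

theorem norm_one_sub_P_le_one (D : EigenSystem T) {s : Finset EigenIndex}
    (hs : (s : Set _) ⊆ D.indices) : ‖1 - D.P s‖ ≤ 1 := by
  refine ContinuousLinearMap.opNorm_le_bound _ zero_le_one fun x => ?_
  rw [one_mul]
  refine D.basis.norm_le_norm_of_norm_inner_le fun i => ?_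
  rw [basis_apply, sub_apply, one_apply_eq_self, inner_sub_right,
    D.inner_P_apply hs i.2]
  split_ifs <;> simp

/-- If the eigenvalues outside `s` have distance at least `c` from `μ`, then `T - μ` is bounded
below by `c` on operators with range orthogonal to the eigenvectors in `s`. -/
theorem mul_norm_le_norm_sub_mul (D : EigenSystem T) (hT : IsSelfAdjoint T)
    {s : Finset EigenIndex} (hs : (s : Set _) ⊆ D.indices) {μ c : ℝ} (hc : 0 ≤ c)
    (hgap : ∀ l ∈ D.indices, l ∉ s → c ≤ |D.val l - μ|) {A : E →L[𝕜] E}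
    (hA : (1 - D.P s) * A = A) : c * ‖A‖ ≤ ‖(T - (μ : 𝕜) • 1) * A‖ := by
  have key : ∀ x, c * ‖A x‖ ≤ ‖((T - (μ : 𝕜) • 1) * A) x‖ := fun x => by
    have := D.basis.norm_le_norm_of_norm_inner_le (x := (c : 𝕜) • A x)
      (y := ((T - (μ : 𝕜) • 1) * A) x) fun i => by
        have h1 : ((T - (μ : 𝕜) • 1) * A) x = T (A x) - (μ : 𝕜) • A x := by simp
        rw [h1, inner_sub_right, hT.inner_eigenvector (D.apply_basis i), inner_smul_right,
          inner_smul_right, ← sub_mul, norm_mul, norm_mul, basis_apply]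
        by_cases his : (i : EigenIndex) ∈ s
        · have : inner 𝕜 (D.vec i) (A x) = 0 := by
            rw [← hA, mul_apply_eq_comp, sub_apply, one_apply_eq_self,
              inner_sub_right, D.inner_P_apply hs i.2, if_pos his, sub_self]
          simp [this]
        · refine mul_le_mul_of_nonneg_right ?_ (norm_nonneg _)
          rw [← RCLike.ofReal_sub, RCLike.norm_ofReal, RCLike.norm_ofReal, abs_of_nonneg hc]
          exact hgap i i.2 his
    rwa [norm_smul, RCLike.norm_ofReal, abs_of_nonneg hc] at this
  have h2 : ‖(c : 𝕜) • A‖ ≤ ‖(T - (μ : 𝕜) • 1) * A‖ :=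
    ContinuousLinearMap.opNorm_le_bound _ (norm_nonneg _) fun x => by
      rw [smul_apply, norm_smul, RCLike.norm_ofReal, abs_of_nonneg hc]
      exact (key x).trans (ContinuousLinearMap.le_opNorm _ _)
  rwa [norm_smul, RCLike.norm_ofReal, abs_of_nonneg hc] at h2

/-- If the eigenvalues in `s` have distance at most `c` from `μ`, then `T - μ` is bounded by `c`
on the spectral subspace of `s`. -/
theorem norm_sub_mul_P_le (D : EigenSystem T) (hT : IsSelfAdjoint T)
    {s : Finset EigenIndex} (hs : (s : Set _) ⊆ D.indices) {μ c : ℝ} (hc : 0 ≤ c)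
    (h : ∀ k ∈ s, |D.val k - μ| ≤ c) : ‖(T - (μ : 𝕜) • 1) * D.P s‖ ≤ c := by
  refine ContinuousLinearMap.opNorm_le_bound _ hc fun x => ?_
  have := D.basis.norm_le_norm_of_norm_inner_le (x := ((T - (μ : 𝕜) • 1) * D.P s) x)
    (y := (c : 𝕜) • x) fun i => by
      have h1 : ((T - (μ : 𝕜) • 1) * D.P s) x = T (D.P s x) - (μ : 𝕜) • D.P s x := by simp
      rw [h1, inner_sub_right, hT.inner_eigenvector (D.apply_basis i), inner_smul_right,
        inner_smul_right, ← sub_mul, norm_mul, norm_mul, basis_apply, D.inner_P_apply hs i.2]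
      split_ifs with his
      · refine mul_le_mul_of_nonneg_right ?_ (norm_nonneg _)
        rw [← RCLike.ofReal_sub, RCLike.norm_ofReal, RCLike.norm_ofReal, abs_of_nonneg hc]
        exact h i his
      · simp; positivity
  rwa [norm_smul, RCLike.norm_ofReal, abs_of_nonneg hc] at this

theorem sub_mul_P_eq_zero (D : EigenSystem T) (hT : IsSelfAdjoint T)
    {s : Finset EigenIndex} (hs : (s : Set _) ⊆ D.indices) {μ : ℝ} (h : ∀ k ∈ s, D.val k = μ) :
    (T - (μ : 𝕜) • 1) * D.P s = 0 :=
  norm_le_zero_iff.1 <| D.norm_sub_mul_P_le hT hs le_rfl fun k hk => by simp [h k hk]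

/-- Splitting `J` into `m` fibres, a bound for an operator on the spectral subspace of each fibre
costs only a factor `√m` on the spectral subspace of `J`, because the fibres are orthogonal. -/
theorem norm_mul_P_le_sqrt_card (D : EigenSystem T) {J : Finset EigenIndex}
    (hJ : (J : Set _) ⊆ D.indices) (f : EigenIndex → ℝ) (A : E →L[𝕜] E) {c : ℝ} (hc : 0 ≤ c)
    (h : ∀ μ ∈ J.image f, ‖A * D.P {k ∈ J | f k = μ}‖ ≤ c) :
    ‖A * D.P J‖ ≤ √(J.image f).card * c := by
  refine ContinuousLinearMap.opNorm_le_bound _ (by positivity) fun x => ?_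
  have hsub : ∀ μ, ((J.filter (f · = μ) : Finset _) : Set EigenIndex) ⊆ D.indices := fun μ =>
    (Finset.coe_subset.2 (Finset.filter_subset _ _)).trans hJ
  have hsq : ∀ s : Finset EigenIndex, (s : Set _) ⊆ D.indices →
      ‖D.P s x‖ ^ 2 = ∑ k ∈ s, ‖inner 𝕜 (D.vec k) x‖ ^ 2 := fun s hs => by
    have h1 : inner 𝕜 (D.P s x) (D.P s x) = ∑ k ∈ s, ((‖inner 𝕜 (D.vec k) x‖ ^ 2 : ℝ) : 𝕜) := by
      conv_lhs => rw [D.P_apply s x, sum_inner]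
      refine Finset.sum_congr rfl fun k hk => ?_
      rw [← D.P_apply, inner_smul_left, D.inner_P_apply hs (hs hk), if_pos hk, RCLike.conj_mul]
      push_cast; rfl
    rw [← inner_self_eq_norm_sq (𝕜 := 𝕜), h1, ← RCLike.ofReal_sum, RCLike.ofReal_re]
  have hPyth : ∑ μ ∈ J.image f, ‖D.P {k ∈ J | f k = μ} x‖ ^ 2 ≤ ‖x‖ ^ 2 := by
    rw [Finset.sum_congr rfl fun μ _ => hsq _ (hsub μ),
      Finset.sum_fiberwise_of_maps_to (fun k hk => Finset.mem_image_of_mem f hk),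
      ← hsq J hJ]
    have := (D.P J).le_of_opNorm_le (D.norm_P_le_one hJ) x
    rw [one_mul] at this
    gcongr
  calc ‖(A * D.P J) x‖ =
        ‖∑ μ ∈ J.image f, (A * D.P {k ∈ J | f k = μ}) (D.P {k ∈ J | f k = μ} x)‖ := by
        congr 1
        rw [← D.sum_P_fiber J f, Finset.mul_sum, sum_apply]
        refine Finset.sum_congr rfl fun μ _ => ?_
        rw [← mul_apply_eq_comp, mul_assoc,
          D.P_mul_P (hsub μ) (hsub μ) subset_rfl]
    _ ≤ ∑ μ ∈ J.image f, c * ‖D.P {k ∈ J | f k = μ} x‖ :=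
        norm_sum_le_of_le _ fun μ hμ => ContinuousLinearMap.le_of_opNorm_le _ (h μ hμ) _
    -- the factor `1` prepares for the Cauchy-Schwarz inequality
    _ = c * ∑ μ ∈ J.image f, 1 * ‖D.P {k ∈ J | f k = μ} x‖ := by simp [Finset.mul_sum]
    _ ≤ c * (√(∑ μ ∈ J.image f, 1 ^ 2) * √(∑ μ ∈ J.image f, ‖D.P {k ∈ J | f k = μ} x‖ ^ 2)) := by
        gcongr
        exact Real.sum_mul_le_sqrt_mul_sqrt _ _ _
    _ ≤ c * (√(J.image f).card * ‖x‖) := by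
        gcongr
        · simp
        · exact Real.sqrt_le_iff.2 ⟨norm_nonneg _, hPyth⟩
    _ = _ := by ring

end EigenSystem

/-! ### Block decomposition by a projection -/

section Blocks

variable {𝕜 : Type*} [RCLike 𝕜] {E : Type*} [NormedAddCommGroup E] [InnerProductSpace 𝕜 E]
  [CompleteSpace E]

theorem ContinuousLinearMap.norm_sq_eq_add_of_isStarProjection {P : E →L[𝕜] E}
    (hP : IsStarProjection P) (x : E) : ‖x‖ ^ 2 = ‖P x‖ ^ 2 + ‖(1 - P) x‖ ^ 2 := by
  have h0 : inner 𝕜 (P x) ((1 - P) x) = 0 := by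
    have h1 := hP.isSelfAdjoint.isSymmetric x ((1 - P) x)
    simp only [ContinuousLinearMap.coe_coe] at h1
    have h2 : P * (1 - P) = 0 := by rw [mul_sub, mul_one, hP.isIdempotentElem.eq, sub_self]
    rw [h1, ← mul_apply_eq_comp, h2]; simp
  have := norm_add_sq_eq_norm_sq_add_norm_sq_of_inner_eq_zero (P x) ((1 - P) x) h0
  simp only [← sq] at this
  rw [← this]
  simp

/-- An operator whose four blocks with respect to a projection are bounded by `m` is bounded
by `2 m`. -/
theorem ContinuousLinearMap.norm_le_two_mul_of_blocks {P X : E →L[𝕜] E} (hP : IsStarProjection P)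
    {m : ℝ} (h₁₁ : ‖P * X * P‖ ≤ m) (h₁₂ : ‖P * X * (1 - P)‖ ≤ m)
    (h₂₁ : ‖(1 - P) * X * P‖ ≤ m) (h₂₂ : ‖(1 - P) * X * (1 - P)‖ ≤ m) : ‖X‖ ≤ 2 * m := by
  have hm : 0 ≤ m := (norm_nonneg _).trans h₁₁
  refine ContinuousLinearMap.opNorm_le_bound _ (by positivity) fun x => ?_
  have hx := norm_sq_eq_add_of_isStarProjection hP x
  have hX := norm_sq_eq_add_of_isStarProjection hP (X x)
  have hrow : ∀ R : E →L[𝕜] E, ‖R * X * P‖ ≤ m → ‖R * X * (1 - P)‖ ≤ m →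
      ‖R (X x)‖ ≤ m * (‖P x‖ + ‖(1 - P) x‖) := fun R h h' => by
    have e : R (X x) = (R * X * P) (P x) + (R * X * (1 - P)) ((1 - P) x) := by
      have h1 : R * X = R * X * P * P + R * X * (1 - P) * (1 - P) := by
        rw [mul_assoc _ P, hP.isIdempotentElem.eq, mul_assoc _ (1 - P),
          hP.one_sub.isIdempotentElem.eq, ← mul_add, add_sub_cancel, mul_one]
      conv_lhs => rw [← mul_apply_eq_comp, h1]
      rfl
    rw [e, mul_add]
    exact norm_add_le_of_le (ContinuousLinearMap.le_of_opNorm_le _ h _)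
      (ContinuousLinearMap.le_of_opNorm_le _ h' _)
  have h1 := pow_le_pow_left₀ (norm_nonneg _) (hrow P h₁₁ h₁₂) 2
  have h2 := pow_le_pow_left₀ (norm_nonneg _) (hrow (1 - P) h₂₁ h₂₂) 2
  refine le_of_sq_le_sq ?_ (by positivity)
  have h3 : (‖P x‖ + ‖(1 - P) x‖) ^ 2 ≤ 2 * ‖x‖ ^ 2 := by
    rw [hx]; exact add_sq_le
  calc ‖X x‖ ^ 2 ≤ 2 * m ^ 2 * (‖P x‖ + ‖(1 - P) x‖) ^ 2 := by
        rw [hX]; refine (add_le_add h1 h2).trans (le_of_eq (by ring))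
    _ ≤ 2 * m ^ 2 * (2 * ‖x‖ ^ 2) := by gcongr
    _ = _ := by ring

end Blocks

namespace EigenSystem

variable {𝕜 : Type*} [RCLike 𝕜] {E : Type*} [NormedAddCommGroup E] [InnerProductSpace 𝕜 E]
  {T : E →L[𝕜] E} {J : Finset EigenIndex} {γ : ℝ}

/-! ### The first-order term -/

/-- The component of `ψ_l` in the first-order correction of the eigenvector `ψ_k` under the
perturbation `A`. -/
noncomputable def vecCorrectionSummand (D : EigenSystem T) (A : E →L[𝕜] E) (k l : EigenIndex) : E :=
  (((D.val k - D.val l)⁻¹ : ℝ) : 𝕜) • inner 𝕜 (D.vec l) (A (D.vec k)) • D.vec l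

/-- The first-order correction `∑_{l ∉ J} ⟪ψ_l, A ψ_k⟫ / (λ_k - λ_l) ψ_l` of the eigenvector `ψ_k`
in the directions outside `J`. -/
noncomputable def vecCorrection (D : EigenSystem T) (A : E →L[𝕜] E) (J : Finset EigenIndex)
    (k : EigenIndex) : E :=
  ∑' l : {l : EigenIndex // l ∈ D.indices ∧ l ∉ J}, D.vecCorrectionSummand A k l

/-- The operator `∑_{k ∈ J} ⟪ψ_k, ·⟫ w_k`, where `w_k` is the first-order correction of `ψ_k`. It is
the half of the first-order term that maps the spectral subspace of `J` to its complement. -/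
noncomputable def halfFirstOrder (D : EigenSystem T) (A : E →L[𝕜] E) (J : Finset EigenIndex) :
    E →L[𝕜] E :=
  ∑ k ∈ J, InnerProductSpace.rankOne 𝕜 (D.vecCorrection A J k) (D.vec k)

theorem halfFirstOrder_mul_P (D : EigenSystem T) (A : E →L[𝕜] E) {s : Finset EigenIndex}
    (hJ : (J : Set _) ⊆ D.indices) (hs : s ⊆ J) : D.halfFirstOrder A J * D.P s =
      ∑ k ∈ s, InnerProductSpace.rankOne 𝕜 (D.vecCorrection A J k) (D.vec k) := by
  rw [halfFirstOrder, Finset.sum_mul, ← Finset.sum_subset hs]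
  · refine Finset.sum_congr rfl fun k hk => ?_
    ext x
    simp [D.inner_P_apply ((Finset.coe_subset.2 hs).trans hJ) (hJ (hs hk)), hk]
  · intro k hk hks
    ext x
    simp [D.inner_P_apply ((Finset.coe_subset.2 hs).trans hJ) (hJ hk), hks]

variable [CompleteSpace E]

theorem isStarProjection_P (D : EigenSystem T) {s : Finset EigenIndex}
    (hs : (s : Set _) ⊆ D.indices) : IsStarProjection (D.P s) :=
  ⟨D.P_mul_P hs hs subset_rfl, D.isSelfAdjoint_P s⟩

theorem firstOrderSummand_eq (D : EigenSystem T) {A : E →L[𝕜] E} (hA : IsSelfAdjoint A)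
    (k l : EigenIndex) : D.firstOrderSummand A k l =
      InnerProductSpace.rankOne 𝕜 (D.vec k) (D.vecCorrectionSummand A k l) +
      InnerProductSpace.rankOne 𝕜 (D.vecCorrectionSummand A k l) (D.vec k) := by
  ext x
  have h : inner 𝕜 (D.vec k) (A (D.vec l)) = inner 𝕜 (A (D.vec k)) (D.vec l) :=
    (hA.isSymmetric _ _).symm
  simp only [firstOrderSummand, Q, vecCorrectionSummand, smul_apply, add_apply,
    ContinuousLinearMap.comp_apply, InnerProductSpace.rankOne_apply, map_smul, inner_smul_left,
    map_mul, RCLike.conj_ofReal, inner_conj_symm, h, smul_add, smul_smul]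
  congr 2 <;> ring

/-- The summands are orthogonal, and their norms are bounded by `γ⁻¹` times the coordinates of
`A ψ_k`, which are square summable. -/
theorem summable_vecCorrectionSummand (D : EigenSystem T) (A : E →L[𝕜] E) (hγ : 0 < γ)
    {k : EigenIndex} (hgap : ∀ l ∈ D.indices, l ∉ J → γ ≤ |D.val l - D.val k|) :
    Summable fun l : {l : EigenIndex // l ∈ D.indices ∧ l ∉ J} =>
      D.vecCorrectionSummand A k l := by
  have hon : Orthonormal 𝕜 fun l : {l : EigenIndex // l ∈ D.indices ∧ l ∉ J} => D.vec l :=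
    D.orthonormal.comp (fun l : {l : EigenIndex // l ∈ D.indices ∧ l ∉ J} => ⟨l, l.2.1⟩)
      fun a b h => Subtype.ext (congrArg (fun i : D.indices => (i : EigenIndex)) h)
  have h1 := (hon.orthogonalFamily.summable_iff_norm_sq_summable
    (f := fun l => (((D.val k - D.val l)⁻¹ : ℝ) : 𝕜) * inner 𝕜 (D.vec l) (A (D.vec k)))).2 <| by
    refine Summable.of_nonneg_of_le (fun _ => by positivity) (fun l => ?_)
      ((hon.inner_products_summable (A (D.vec k))).mul_left ((γ⁻¹) ^ 2))
    rw [norm_mul, mul_pow, RCLike.norm_ofReal, abs_inv, abs_sub_comm]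
    have := hgap l l.2.1 l.2.2
    gcongr
  refine h1.congr fun l => ?_
  simp [vecCorrectionSummand, smul_smul]

theorem inner_vecCorrection (D : EigenSystem T) (A : E →L[𝕜] E) (hγ : 0 < γ)
    {k : EigenIndex} (hgap : ∀ l ∈ D.indices, l ∉ J → γ ≤ |D.val l - D.val k|)
    {i : EigenIndex} (hi : i ∈ D.indices) :
    inner 𝕜 (D.vec i) (D.vecCorrection A J k) =
      if i ∈ J then 0 else
        (((D.val k - D.val i)⁻¹ : ℝ) : 𝕜) * inner 𝕜 (D.vec i) (A (D.vec k)) := by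
  have h := ((D.summable_vecCorrectionSummand A hγ hgap).hasSum).mapL (innerSL 𝕜 (D.vec i))
  refine h.unique ?_
  have hterm : ∀ l : {l : EigenIndex // l ∈ D.indices ∧ l ∉ J}, i ≠ l →
      innerSL 𝕜 (D.vec i) (D.vecCorrectionSummand A k l) = 0 := fun l hl => by
    rw [innerSL_apply_apply, vecCorrectionSummand, inner_smul_right, inner_smul_right,
      D.inner_vec hi l.2.1, if_neg hl]
    simp
  split_ifs with hiJ
  · rw [show (fun l : {l : EigenIndex // l ∈ D.indices ∧ l ∉ J} =>
      innerSL 𝕜 (D.vec i) (D.vecCorrectionSummand A k l)) = fun _ => 0 from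
      funext fun l => hterm l fun h => l.2.2 (h ▸ hiJ)]
    exact hasSum_zero
  · have := hasSum_single (f := fun l : {l : EigenIndex // l ∈ D.indices ∧ l ∉ J} =>
      innerSL 𝕜 (D.vec i) (D.vecCorrectionSummand A k l)) ⟨i, hi, hiJ⟩
      fun l hl => hterm l fun h => hl (Subtype.ext h.symm)
    convert this using 1
    rw [innerSL_apply_apply, vecCorrectionSummand, inner_smul_right, inner_smul_right,
      D.inner_vec hi hi, if_pos rfl, mul_one]

/-- The series in the first-order term converges unconditionally in the operator norm: its summands
depend continuously and linearly on those of the vector series for the correction of `ψ_k`. -/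
theorem hasSum_firstOrderSummand (D : EigenSystem T) {A : E →L[𝕜] E} (hA : IsSelfAdjoint A)
    (hγ : 0 < γ) {k : EigenIndex} (hgap : ∀ l ∈ D.indices, l ∉ J → γ ≤ |D.val l - D.val k|) :
    HasSum (fun l : {l : EigenIndex // l ∈ D.indices ∧ l ∉ J} => D.firstOrderSummand A k l)
      (InnerProductSpace.rankOne 𝕜 (D.vec k) (D.vecCorrection A J k) +
        InnerProductSpace.rankOne 𝕜 (D.vecCorrection A J k) (D.vec k)) := by
  have h := (D.summable_vecCorrectionSummand A hγ hgap).hasSum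
  simp only [D.firstOrderSummand_eq hA]
  refine HasSum.add (h.mapL (InnerProductSpace.rankOne 𝕜 (D.vec k))) ?_
  exact h.mapL ((InnerProductSpace.rankOne 𝕜 : E →L[𝕜] E →L⋆[𝕜] E →L[𝕜] E).flip (D.vec k))

theorem firstOrder_eq (D : EigenSystem T) {A : E →L[𝕜] E} (hA : IsSelfAdjoint A)
    (hγ : 0 < γ) (hgap : ∀ k ∈ J, ∀ l ∈ D.indices, l ∉ J → γ ≤ |D.val l - D.val k|) :
    D.firstOrder A J = D.halfFirstOrder A J + star (D.halfFirstOrder A J) := by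
  rw [firstOrder, Finset.sum_congr rfl fun k hk =>
    (D.hasSum_firstOrderSummand hA hγ (hgap k hk)).tsum_eq, Finset.sum_add_distrib, add_comm,
    halfFirstOrder, star_sum]
  congr 1
  exact Finset.sum_congr rfl fun k _ => by
    rw [ContinuousLinearMap.star_eq_adjoint, InnerProductSpace.adjoint_rankOne]

theorem P_mul_halfFirstOrder (D : EigenSystem T) (A : E →L[𝕜] E) (hγ : 0 < γ)
    (hJ : (J : Set _) ⊆ D.indices)
    (hgap : ∀ k ∈ J, ∀ l ∈ D.indices, l ∉ J → γ ≤ |D.val l - D.val k|) :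
    D.P J * D.halfFirstOrder A J = 0 := by
  rw [halfFirstOrder, Finset.mul_sum]
  refine Finset.sum_eq_zero fun k hk => ?_
  have h : D.P J (D.vecCorrection A J k) = 0 := D.ext_inner fun i hi => by
    rw [D.inner_P_apply hJ hi, D.inner_vecCorrection A hγ (hgap k hk) hi]
    split_ifs <;> simp
  ext x
  simp [h]

/-- The Sylvester equation solved by the first-order term, on the spectral subspace of a subset `s`
of `J` at which all eigenvalues equal `μ`. -/
theorem sub_mul_halfFirstOrder_mul_P (D : EigenSystem T) (hT : IsSelfAdjoint T) (A : E →L[𝕜] E)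
    (hγ : 0 < γ) (hJ : (J : Set _) ⊆ D.indices)
    (hgap : ∀ k ∈ J, ∀ l ∈ D.indices, l ∉ J → γ ≤ |D.val l - D.val k|)
    {s : Finset EigenIndex} (hs : s ⊆ J) {μ : ℝ} (hμ : ∀ k ∈ s, D.val k = μ) :
    (T - (μ : 𝕜) • 1) * (D.halfFirstOrder A J * D.P s) = -((1 - D.P J) * A * D.P s) := by
  rw [D.halfFirstOrder_mul_P A hJ hs, show D.P s = ∑ k ∈ s, D.Q k from rfl,
    Finset.mul_sum, Finset.mul_sum, ← Finset.sum_neg_distrib]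
  refine Finset.sum_congr rfl fun k hk => ?_
  have h : (T - (μ : 𝕜) • 1) (D.vecCorrection A J k) = -((1 - D.P J) (A (D.vec k))) := by
    refine D.ext_inner fun i hi => ?_
    simp only [sub_apply, smul_apply, one_apply_eq_self, inner_sub_right, inner_neg_right,
      inner_smul_right, hT.inner_eigenvector (D.apply_vec i hi), D.inner_P_apply hJ hi,
      D.inner_vecCorrection A hγ (hgap k (hs hk)) hi]
    split_ifs with hiJ
    · simp
    · have h1 := hgap k (hs hk) i hi hiJ
      have h2 : D.val k - D.val i ≠ 0 := fun h0 => by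
        rw [← neg_sub, h0, neg_zero, abs_zero] at h1
        exact absurd hγ (not_lt.2 h1)
      have h3 : ((D.val i : 𝕜) - (D.val k : 𝕜)) * (((D.val k - D.val i)⁻¹ : ℝ) : 𝕜) = -1 := by
        have : (D.val i - D.val k) * (D.val k - D.val i)⁻¹ = -1 := by field_simp; ring
        exact_mod_cast congrArg (RCLike.ofReal : ℝ → 𝕜) this
      rw [sub_zero, ← sub_mul, ← mul_assoc, ← hμ k hk, h3, neg_one_mul]
  ext x
  simp only [mul_apply_eq_comp, neg_apply, InnerProductSpace.rankOne_apply, map_smul, h, Q,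
    smul_neg]

end EigenSystem

/-! ### The second-order bound -/

theorem ContinuousLinearMap.sub_smul_one_mul_one_sub_comm {𝕜 : Type*} [RCLike 𝕜] {E : Type*}
    [NormedAddCommGroup E] [InnerProductSpace 𝕜 E] {A P : E →L[𝕜] E} (h : A * P = P * A) (a : 𝕜) :
    (A - a • 1) * (1 - P) = (1 - P) * (A - a • 1) :=
  ((Commute.one_right _).sub_right
    (Commute.sub_left h ((Commute.one_left P).smul_left a))).eq

namespace EigenSystem

section SecondOrder

variable {𝕜 : Type*} [RCLike 𝕜] {E : Type*} [NormedAddCommGroup E] [InnerProductSpace 𝕜 E]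
  [CompleteSpace E] {H H' : E →L[𝕜] E} {J : Finset EigenIndex}

/-- Davis-Kahan estimate for the part of the unperturbed spectral subspace that leaves the
perturbed one. -/
theorem norm_one_sub_P_mul_P_le (hH : IsSelfAdjoint H) (hH' : IsSelfAdjoint H')
    (D : EigenSystem H) (D' : EigenSystem H') (hJ : (J : Set _) ⊆ D.indices)
    (hJ' : (J : Set _) ⊆ D'.indices) {c : ℝ} (hc : 0 < c)
    (hgap' : ∀ k ∈ J, ∀ l ∈ D'.indices, l ∉ J → c ≤ |D'.val l - D.val k|) :
    ‖(1 - D'.P J) * D.P J‖ ≤ √(J.image D.val).card * (‖H' - H‖ / c) := by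
  refine D.norm_mul_P_le_sqrt_card hJ D.val _ (by positivity) fun μ hμ => ?_
  obtain ⟨k₀, hk₀, rfl⟩ := Finset.mem_image.1 hμ
  set s := J.filter (D.val · = D.val k₀)
  have hs : (s : Set _) ⊆ D.indices := (Finset.coe_subset.2 (Finset.filter_subset _ _)).trans hJ
  have hidem := (D'.isStarProjection_P hJ').one_sub.isIdempotentElem.eq
  have h1 := D'.mul_norm_le_norm_sub_mul hH' hJ' hc.le (hgap' k₀ hk₀)
    (A := (1 - D'.P J) * D.P s) (by rw [← mul_assoc, hidem])
  have h0 := D.sub_mul_P_eq_zero hH hs (μ := D.val k₀) fun k hk => (Finset.mem_filter.1 hk).2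
  have hcomm := D'.mul_P_eq_P_mul hH' hJ'
  have e : (H' - (D.val k₀ : 𝕜) • 1) * ((1 - D'.P J) * D.P s) =
      (1 - D'.P J) * ((H' - H) * D.P s) := by
    have e1 : (H' - (D.val k₀ : 𝕜) • 1) * (1 - D'.P J) =
        (1 - D'.P J) * (H' - (D.val k₀ : 𝕜) • 1) := 
      ContinuousLinearMap.sub_smul_one_mul_one_sub_comm hcomm _
    have e2 : (H' - (D.val k₀ : 𝕜) • 1) * D.P s = (H' - H) * D.P s := by
      rw [← sub_eq_zero, ← sub_mul, ← h0]; congr 1; abel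
    rw [← mul_assoc, e1, mul_assoc, e2]
  rw [le_div_iff₀ hc, mul_comm]
  refine h1.trans ?_
  rw [e]
  calc _ ≤ 1 * (‖H' - H‖ * 1) := norm_mul_le_of_le (D'.norm_one_sub_P_le_one hJ')
        (norm_mul_le_of_le le_rfl (D.norm_P_le_one hs))
    _ = _ := by ring

/-- Davis-Kahan estimate for the part of the perturbed spectral subspace that leaves the
unperturbed one. The perturbed eigenvalues are grouped by the unperturbed values. -/
theorem norm_one_sub_P_mul_P_le' (hH : IsSelfAdjoint H) (hH' : IsSelfAdjoint H')
    (D : EigenSystem H) (D' : EigenSystem H') (hJ : (J : Set _) ⊆ D.indices)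
    (hJ' : (J : Set _) ⊆ D'.indices) {γ : ℝ} (hγ : ‖H' - H‖ < γ)
    (hgap : ∀ k ∈ J, ∀ l ∈ D.indices, l ∉ J → γ ≤ |D.val l - D.val k|)
    (hval : ∀ k ∈ J, |D'.val k - D.val k| ≤ ‖H' - H‖) :
    ‖(1 - D.P J) * D'.P J‖ ≤ √(J.image D.val).card * (‖H' - H‖ / (γ - ‖H' - H‖)) := by
  have hc : 0 < γ - ‖H' - H‖ := sub_pos.2 hγ
  refine D'.norm_mul_P_le_sqrt_card hJ' D.val _ (by positivity) fun μ hμ => ?_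
  obtain ⟨k₀, hk₀, rfl⟩ := Finset.mem_image.1 hμ
  set s := J.filter (D.val · = D.val k₀)
  have hs : (s : Set _) ⊆ D'.indices := (Finset.coe_subset.2 (Finset.filter_subset _ _)).trans hJ'
  have hidem := (D.isStarProjection_P hJ).one_sub.isIdempotentElem.eq
  have h1 := D.mul_norm_le_norm_sub_mul hH hJ ((norm_nonneg _).trans hγ.le) (hgap k₀ hk₀)
    (A := (1 - D.P J) * D'.P s) (by rw [← mul_assoc, hidem])
  have h0 := D'.norm_sub_mul_P_le hH' hs (μ := D.val k₀) (norm_nonneg (H' - H)) fun k hk => by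
    have hk := Finset.mem_filter.1 hk
    rw [← hk.2]; exact hval k hk.1
  have hcomm := D.mul_P_eq_P_mul hH hJ
  have hcomm' := D'.mul_P_eq_P_mul hH' hs
  have hP' := D'.P_mul_P hs hs subset_rfl
  have e : (H - (D.val k₀ : 𝕜) • 1) * ((1 - D.P J) * D'.P s) =
      (1 - D.P J) * D'.P s * ((H' - (D.val k₀ : 𝕜) • 1) * D'.P s) -
        (1 - D.P J) * ((H' - H) * D'.P s) := by
    have e1 : (H - (D.val k₀ : 𝕜) • 1) * (1 - D.P J) =
        (1 - D.P J) * (H - (D.val k₀ : 𝕜) • 1) := 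
      ContinuousLinearMap.sub_smul_one_mul_one_sub_comm hcomm _
    have e2 : D'.P s * ((H' - (D.val k₀ : 𝕜) • 1) * D'.P s) =
        (H' - (D.val k₀ : 𝕜) • 1) * D'.P s := by
      simp only [sub_mul, mul_sub, one_mul, smul_mul_assoc, mul_smul_comm, hcomm', hP',
        ← mul_assoc]
    rw [← mul_assoc, e1, mul_assoc, mul_assoc (1 - D.P J) (D'.P s), e2, ← mul_sub, ← sub_mul,
      sub_right_comm, sub_sub_cancel]
  rw [le_div_iff₀ hc]
  have h2 : ‖(H - (D.val k₀ : 𝕜) • 1) * ((1 - D.P J) * D'.P s)‖ ≤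
      ‖(1 - D.P J) * D'.P s‖ * ‖H' - H‖ + 1 * (‖H' - H‖ * 1) := by
    rw [e]
    exact norm_sub_le_of_le (norm_mul_le_of_le le_rfl h0)
      (norm_mul_le_of_le (D.norm_one_sub_P_le_one hJ)
        (norm_mul_le_of_le le_rfl (D'.norm_P_le_one hs)))
  linarith [h1.trans h2]

/-- The off-diagonal block of the remainder solves a Sylvester equation with right side
`(1 - P) (P' A + A (1 - P')) P`, where `A = H' - H`. This is of second order, since `(1 - P) P'` and
`(1 - P') P` are of first order. -/
theorem norm_offDiagonal_le (hH : IsSelfAdjoint H) (hH' : IsSelfAdjoint H')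
    (D : EigenSystem H) (D' : EigenSystem H') (hJ : (J : Set _) ⊆ D.indices)
    (hJ' : (J : Set _) ⊆ D'.indices) {γ : ℝ} (hγ : 0 < γ)
    (hgap : ∀ k ∈ J, ∀ l ∈ D.indices, l ∉ J → γ ≤ |D.val l - D.val k|) {b : ℝ}
    (hs : ‖(1 - D'.P J) * D.P J‖ ≤ b) (ht : ‖(1 - D.P J) * D'.P J‖ ≤ b) :
    ‖(1 - D.P J) * (D'.P J - D.halfFirstOrder (H' - H) J) * D.P J‖ ≤
      √(J.image D.val).card * (2 * b * ‖H' - H‖ / γ) := by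
  have hb : 0 ≤ b := (norm_nonneg _).trans hs
  refine D.norm_mul_P_le_sqrt_card hJ D.val _ (by positivity) fun μ hμ => ?_
  obtain ⟨k₀, hk₀, rfl⟩ := Finset.mem_image.1 hμ
  set s := J.filter (D.val · = D.val k₀)
  have hsJ : s ⊆ J := Finset.filter_subset _ _
  have hsμ : ∀ k ∈ s, D.val k = D.val k₀ := fun k hk => (Finset.mem_filter.1 hk).2
  have hs' : (s : Set _) ⊆ D.indices := (Finset.coe_subset.2 hsJ).trans hJ
  have hidem := (D.isStarProjection_P hJ).one_sub.isIdempotentElem.eq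
  set W := D.halfFirstOrder (H' - H) J
  set P := D.P J
  set P' := D'.P J
  set R := D.P s
  have h1 := D.mul_norm_le_norm_sub_mul hH hJ hγ.le (hgap k₀ hk₀)
    (A := (1 - P) * (P' - W) * R) (by rw [← mul_assoc, ← mul_assoc, hidem])
  have h0 : (H - (D.val k₀ : 𝕜) • 1) * R = 0 := D.sub_mul_P_eq_zero hH hs' hsμ
  have hW : (H - (D.val k₀ : 𝕜) • 1) * (W * R) = -((1 - P) * (H' - H) * R) :=
    D.sub_mul_halfFirstOrder_mul_P hH (H' - H) hγ hJ hgap hsJ hsμ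
  have hPW : P * W = 0 := D.P_mul_halfFirstOrder _ hγ hJ hgap
  have hPR : P * R = R := D.P_mul_P hs' hJ hsJ
  have hcomm : H * P = P * H := D.mul_P_eq_P_mul hH hJ
  have hcomm' : H' * P' = P' * H' := D'.mul_P_eq_P_mul hH' hJ'
  have e : (H - (D.val k₀ : 𝕜) • 1) * ((1 - P) * (P' - W) * R) =
      (1 - P) * P' * (H' - H) * R + (1 - P) * (H' - H) * ((1 - P') * P * R) := by
    have e1 : (H - (D.val k₀ : 𝕜) • 1) * (1 - P) =
        (1 - P) * (H - (D.val k₀ : 𝕜) • 1) := 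
      ContinuousLinearMap.sub_smul_one_mul_one_sub_comm hcomm _
    have e2 : (1 - P) * (P' - W) * R = (1 - P) * P' * R - W * R := by
      have : (1 - P) * W = W := by rw [sub_mul, one_mul, hPW, sub_zero]
      rw [mul_sub, this, sub_mul]
    have e3 : (H - (D.val k₀ : 𝕜) • 1) * P' * R =
        (P' * (H' - H) - (H' - H) * P') * R := by
      have h4 : P' * ((H - (D.val k₀ : 𝕜) • 1) * R) = 0 := by rw [h0, mul_zero]
      rw [← sub_zero ((H - (D.val k₀ : 𝕜) • 1) * P' * R), ← h4, ← mul_assoc, ← sub_mul]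
      congr 1
      simp only [sub_mul, mul_sub, mul_one, one_mul, hcomm', smul_mul_assoc, mul_smul_comm]
      abel
    rw [e2, mul_sub, hW, ← mul_assoc, ← mul_assoc, e1, mul_assoc (1 - P), mul_assoc (1 - P), e3,
      mul_assoc _ P R, hPR]
    noncomm_ring
  have h2 : ‖(H - (D.val k₀ : 𝕜) • 1) * ((1 - P) * (P' - W) * R)‖ ≤
      b * ‖H' - H‖ * 1 + 1 * ‖H' - H‖ * (b * 1) := by
    rw [e]
    exact norm_add_le_of_le
      (norm_mul_le_of_le (norm_mul_le_of_le ht le_rfl) (D.norm_P_le_one hs'))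
      (norm_mul_le_of_le (norm_mul_le_of_le (D.norm_one_sub_P_le_one hJ) le_rfl)
        (norm_mul_le_of_le hs (D.norm_P_le_one hs')))
  rw [le_div_iff₀ hγ]
  linarith [h1.trans h2]

/-- The second-order bound, once the perturbed eigenvalues are known to be close to the
unperturbed ones and to respect the gap. -/
theorem norm_P_sub_P_sub_firstOrder_le (hH : IsSelfAdjoint H) (hH' : IsSelfAdjoint H')
    (D : EigenSystem H) (D' : EigenSystem H') (hJ : (J : Set _) ⊆ D.indices)
    (hJ' : (J : Set _) ⊆ D'.indices) {γ : ℝ} (hγ : 0 < γ) (hclose : ‖H' - H‖ / γ < 1 / 4)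
    (hgap : ∀ k ∈ J, ∀ l ∈ D.indices, l ∉ J → γ ≤ |D.val l - D.val k|)
    (hgap' : ∀ k ∈ J, ∀ l ∈ D'.indices, l ∉ J → γ - ‖H' - H‖ ≤ |D'.val l - D.val k|)
    (hval : ∀ k ∈ J, |D'.val k - D.val k| ≤ ‖H' - H‖) :
    ‖D'.P J - D.P J - D.firstOrder (H' - H) J‖ ≤
      8 * ((J.image D.val).card : ℝ) * (‖H' - H‖ / γ) ^ 2 := by
  have hδ := norm_nonneg (H' - H)
  have hlt : ‖H' - H‖ < γ / 4 := by rw [div_lt_iff₀ hγ] at hclose; linarith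
  set K : ℝ := ((J.image D.val).card : ℝ) with hK
  set ε := ‖H' - H‖ / γ with hε
  have hε0 : 0 ≤ ε := by positivity
  -- as `‖H' - H‖ < γ / 4`, shrinking the gap by `‖H' - H‖` costs a factor of at most `4 / 3`
  have hquot : ‖H' - H‖ / (γ - ‖H' - H‖) ≤ 4 / 3 * ε := by
    rw [hε, div_le_iff₀ (by linarith)]
    have : 4 / 3 * (‖H' - H‖ / γ) * (γ - ‖H' - H‖) ≥ 4 / 3 * (‖H' - H‖ / γ) * (3 / 4 * γ) := by
      gcongr; linarith
    refine le_trans (le_of_eq ?_) this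
    field_simp
  have hs : ‖(1 - D'.P J) * D.P J‖ ≤ √K * (4 / 3 * ε) :=
    (norm_one_sub_P_mul_P_le hH hH' D D' hJ hJ' (by linarith) hgap').trans (by gcongr)
  have ht : ‖(1 - D.P J) * D'.P J‖ ≤ √K * (4 / 3 * ε) :=
    (norm_one_sub_P_mul_P_le' hH hH' D D' hJ hJ' (by linarith) hgap hval).trans (by gcongr)
  have hoff := norm_offDiagonal_le hH hH' D D' hJ hJ' hγ hgap hs ht
  have hP := D.isStarProjection_P hJ
  have hP' := D'.isStarProjection_P hJ'
  have hA : IsSelfAdjoint (H' - H) := hH'.sub hH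
  have hPW : D.P J * D.halfFirstOrder (H' - H) J = 0 := D.P_mul_halfFirstOrder _ hγ hJ hgap
  have hWP : D.halfFirstOrder (H' - H) J * D.P J = D.halfFirstOrder (H' - H) J :=
    D.halfFirstOrder_mul_P _ hJ subset_rfl
  rw [D.firstOrder_eq hA hγ hgap]
  set W := D.halfFirstOrder (H' - H) J
  set P := D.P J
  set P' := D'.P J
  have hPi : P * P = P := hP.isIdempotentElem.eq
  have hPi' : P' * P' = P' := hP'.isIdempotentElem.eq
  have hPs : star P = P := hP.isSelfAdjoint
  have hPs' : star P' = P' := hP'.isSelfAdjoint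
  have hWsP : star W * P = 0 := by rw [← hPs, ← star_mul, hPW, star_zero]
  have hPWs : P * star W = star W := by
    conv_lhs => rw [← hPs, ← star_mul, hWP]
  have hsq : √K * √K = K := Real.mul_self_sqrt (by positivity)
  have hm : (√K * (4 / 3 * ε)) * (√K * (4 / 3 * ε)) ≤ 8 / 3 * K * ε ^ 2 := by
    have h1 : (√K * (4 / 3 * ε)) * (√K * (4 / 3 * ε)) = (√K * √K) * (16 / 9 * ε ^ 2) := by ring
    rw [h1, hsq]
    have : 0 ≤ K * ε ^ 2 := by positivity
    linarith
  have h21 : (1 - P) * (P' - P - (W + star W)) * P = (1 - P) * (P' - W) * P := by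
    simp only [sub_mul, mul_sub, mul_add, add_mul, one_mul, mul_assoc, hPi, hWsP, mul_zero]
    abel
  have b21 : ‖(1 - P) * (P' - P - (W + star W)) * P‖ ≤ 8 / 3 * K * ε ^ 2 := by
    rw [h21]
    refine hoff.trans (le_of_eq ?_)
    rw [mul_div_assoc, ← hε, ← hK]
    calc _ = √K * √K * (8 / 3 * ε ^ 2) := by ring
      _ = _ := by rw [hsq]; ring
  have b12 : ‖P * (P' - P - (W + star W)) * (1 - P)‖ ≤ 8 / 3 * K * ε ^ 2 := by
    rw [← norm_star]
    refine le_trans (le_of_eq ?_) b21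
    simp only [star_mul, star_sub, star_add, star_star, star_one, hPs, hPs', mul_assoc,
      add_comm (star W)]
  have b11 : ‖P * (P' - P - (W + star W)) * P‖ ≤ 8 / 3 * K * ε ^ 2 := by
    have : P * (P' - P - (W + star W)) * P = -(star ((1 - P') * P) * ((1 - P') * P)) := by
      simp only [star_mul, star_sub, star_one, hPs, hPs']
      simp only [sub_mul, mul_sub, mul_add, add_mul, one_mul, mul_one, mul_assoc, hPi, hWsP,
        mul_zero, ← mul_assoc P' P', hPi', hPW, zero_mul]
      abel
    rw [this, norm_neg]
    exact (norm_mul_le_of_le ((norm_star _).trans_le hs) hs).trans hm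
  have b22 : ‖(1 - P) * (P' - P - (W + star W)) * (1 - P)‖ ≤ 8 / 3 * K * ε ^ 2 := by
    have : (1 - P) * (P' - P - (W + star W)) * (1 - P) =
        ((1 - P) * P') * star ((1 - P) * P') := by
      simp only [star_mul, star_sub, star_one, hPs, hPs']
      simp only [sub_mul, mul_sub, mul_add, add_mul, one_mul, mul_one, mul_assoc, hPi, hWsP,
        ← mul_assoc P' P', hPi', hWP, hPW, hPWs, zero_mul]
      abel
    rw [this]
    exact (norm_mul_le_of_le ht ((norm_star _).trans_le ht)).trans hm
  refine (ContinuousLinearMap.norm_le_two_mul_of_blocks hP b11 b12 b21 b22).trans ?_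
  have : 0 ≤ K * ε ^ 2 := by positivity
  linarith

end SecondOrder

end EigenSystem

namespace EigenSystem

/-! ### Comparison of eigenvalues -/

section Weyl

variable {𝕜 : Type*} [RCLike 𝕜] {E : Type*} [NormedAddCommGroup E] [InnerProductSpace 𝕜 E]
  {T : E →L[𝕜] E}

theorem top_mem_of_le (D : EigenSystem T) {m n : ℕ} (h : m ≤ n)
    (hn : EigenIndex.top n ∈ D.indices) : EigenIndex.top m ∈ D.indices := by
  induction n, h using Nat.le_induction with
  | base => exact hn
  | succ n _ ih => exact ih (D.top_succ n hn).1

theorem val_top_le (D : EigenSystem T) {m n : ℕ} (h : m ≤ n)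
    (hn : EigenIndex.top n ∈ D.indices) :
    D.val (EigenIndex.top n) ≤ D.val (EigenIndex.top m) := by
  induction n, h using Nat.le_induction with
  | base => exact le_rfl
  | succ n _ ih => exact (D.top_succ n hn).2.trans (ih (D.top_succ n hn).1)

theorem bot_mem_of_le (D : EigenSystem T) {m n : ℕ} (h : m ≤ n)
    (hn : EigenIndex.bot n ∈ D.indices) : EigenIndex.bot m ∈ D.indices := by
  induction n, h using Nat.le_induction with
  | base => exact hn
  | succ n _ ih => exact ih (D.bot_succ n hn).1

theorem val_bot_le (D : EigenSystem T) {m n : ℕ} (h : m ≤ n)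
    (hn : EigenIndex.bot n ∈ D.indices) :
    D.val (EigenIndex.bot m) ≤ D.val (EigenIndex.bot n) := by
  induction n, h using Nat.le_induction with
  | base => exact le_rfl
  | succ n _ ih => exact (ih (D.bot_succ n hn).1).trans (D.bot_succ n hn).2

open Classical in
/-- The eigenvalue at an index in use, and `0` at every other index. In infinite dimension this
extension by `0` is the one for which Weyl's inequality holds at every index, as `0` is the
limit of each infinite list. -/
noncomputable def extVal (D : EigenSystem T) (i : EigenIndex) : ℝ :=
  if i ∈ D.indices then D.val i else 0

theorem extVal_of_mem (D : EigenSystem T) {i : EigenIndex} (hi : i ∈ D.indices) :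
    D.extVal i = D.val i := if_pos hi

theorem extVal_of_notMem (D : EigenSystem T) {i : EigenIndex} (hi : i ∉ D.indices) :
    D.extVal i = 0 := if_neg hi

theorem extVal_top_nonneg (D : EigenSystem T) (hE : ¬ FiniteDimensional 𝕜 E) (m : ℕ) :
    0 ≤ D.extVal (EigenIndex.top m) := by
  unfold extVal
  split_ifs with h
  exacts [D.top_nonneg hE m h, le_rfl]

theorem extVal_bot_nonpos (D : EigenSystem T) (hE : ¬ FiniteDimensional 𝕜 E) (m : ℕ) :
    D.extVal (EigenIndex.bot m) ≤ 0 := by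
  unfold extVal
  split_ifs with h
  exacts [D.bot_nonpos hE m h, le_rfl]

theorem extVal_ker (D : EigenSystem T) (hE : ¬ FiniteDimensional 𝕜 E) (m : ℕ) :
    D.extVal (EigenIndex.ker m) = 0 := by
  unfold extVal
  split_ifs with h
  exacts [D.ker_eq_zero hE m h, rfl]

open Classical in
/-- The first `m` indices of the list `f`, as far as they are in use. -/
noncomputable def initial (D : EigenSystem T) (f : ℕ → EigenIndex) (m : ℕ) : Finset D.indices :=
  ((Finset.range m).image f).subtype (· ∈ D.indices)

theorem mem_initial (D : EigenSystem T) {f : ℕ → EigenIndex} {m : ℕ} {i : D.indices} :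
    i ∈ D.initial f m ↔ ∃ n < m, f n = i := by
  simp [initial]

open Classical in
theorem card_initial_le (D : EigenSystem T) (f : ℕ → EigenIndex) (m : ℕ) :
    (D.initial f m).card ≤ m := by
  rw [initial, Finset.card_subtype]
  exact (Finset.card_filter_le _ _).trans (Finset.card_image_le.trans (by simp))

open Classical in
theorem card_initial (D : EigenSystem T) {f : ℕ → EigenIndex} (hf : Function.Injective f) {m : ℕ}
    (h : ∀ n < m, f n ∈ D.indices) : (D.initial f m).card = m := by
  rw [initial, Finset.card_subtype, Finset.filter_true_of_mem, Finset.card_image_of_injective _ hf,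
    Finset.card_range]
  simpa using h

theorem infinite_indices (hE : ¬ FiniteDimensional 𝕜 E) (D : EigenSystem T) :
    D.indices.Infinite := by
  intro hfin
  have : FiniteDimensional 𝕜 (Submodule.span 𝕜 (D.vec '' D.indices)) :=
    FiniteDimensional.span_of_finite 𝕜 (hfin.image _)
  have h := D.complete
  rw [(Submodule.closed_of_finiteDimensional _).submodule_topologicalClosure_eq] at h
  rw [h] at this
  exact hE (Module.Finite.equiv (Submodule.topEquiv (R := 𝕜) (M := E)))

/-- In infinite dimension the eigenvalues outside the finite set `J` accumulate at `0`, so the gap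
also separates the eigenvalues in `J` from `0`. -/
theorem le_abs_val_of_gap (hE : ¬ FiniteDimensional 𝕜 E) (hT : IsCompactOperator T)
    (D : EigenSystem T) {J : Finset EigenIndex} {γ μ : ℝ}
    (hgap : ∀ l ∈ D.indices, l ∉ J → γ ≤ |D.val l - μ|) : γ ≤ |μ| := by
  refine le_of_forall_pos_le_add fun ε hε => ?_
  have hfin : {i : D.indices | ε ≤ |D.val i|}.Finite :=
    D.orthonormal.finite_le_norm_of_isCompactOperator hT (fun i => D.apply_vec i i.2) hε
  obtain ⟨l, hl, hl'⟩ := ((D.infinite_indices hE).sdiff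
    ((hfin.image (fun i : D.indices => (i : EigenIndex))).union J.finite_toSet)).nonempty
  rw [Set.mem_union, not_or] at hl'
  have h1 : |D.val l| < ε := not_le.1 fun h => hl'.1 ⟨⟨l, hl⟩, h, rfl⟩
  have h2 := hgap l hl hl'.2
  have h3 := abs_sub (D.val l) μ
  linarith

variable [CompleteSpace E] {H H' : E →L[𝕜] E}

/-- Min-max comparison of the lists counted from the top: only the perturbed eigenvalues at the
first `m` indices may exceed `c`. -/
theorem val_top_le_add (hH : IsSelfAdjoint H) (hH' : IsSelfAdjoint H')
    (D : EigenSystem H) (D' : EigenSystem H') {m : ℕ} (hm : EigenIndex.top m ∈ D.indices) {c : ℝ}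
    (hc : ∀ l ∈ D'.indices, (∀ n < m, EigenIndex.top n ≠ l) → D'.val l ≤ c) :
    D.val (EigenIndex.top m) ≤ c + ‖H' - H‖ := by
  refine D.basis.le_add_norm_sub_of_card_lt D'.basis hH hH' D.apply_basis D'.apply_basis
    (D.initial EigenIndex.top (m + 1)) (D'.initial EigenIndex.top m) ?_ ?_ ?_
  · rw [D.card_initial (fun _ _ => EigenIndex.top.inj) fun n hn =>
      D.top_mem_of_le (Nat.lt_succ_iff.1 hn) hm]
    exact Nat.lt_succ_of_le (D'.card_initial_le _ _)
  · intro i hi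
    obtain ⟨n, hn, hni⟩ := D.mem_initial.1 hi
    rw [← hni]
    exact D.val_top_le (Nat.lt_succ_iff.1 hn) hm
  · intro l hl
    exact hc l l.2 fun n hn h => hl (D'.mem_initial.2 ⟨n, hn, h⟩)

/-- Min-max comparison of the lists counted from the bottom, that is `val_top_le_add` for the
negated operators. -/
theorem le_val_bot_add (hH : IsSelfAdjoint H) (hH' : IsSelfAdjoint H')
    (D : EigenSystem H) (D' : EigenSystem H') {m : ℕ} (hm : EigenIndex.bot m ∈ D.indices) {c : ℝ}
    (hc : ∀ l ∈ D'.indices, (∀ n < m, EigenIndex.bot n ≠ l) → c ≤ D'.val l) :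
    c ≤ D.val (EigenIndex.bot m) + ‖H' - H‖ := by
  have := D.basis.le_add_norm_sub_of_card_lt D'.basis hH.neg hH'.neg
    (val := fun i => -D.val i) (val' := fun i => -D'.val i) (a := -D.val (EigenIndex.bot m))
    (c := -c) (fun i => by simp [D.apply_vec i i.2]) (fun i => by simp [D'.apply_vec i i.2])
    (D.initial EigenIndex.bot (m + 1)) (D'.initial EigenIndex.bot m) ?_ ?_ ?_
  · rw [neg_sub_neg, norm_sub_rev] at this
    linarith
  · rw [D.card_initial (fun _ _ => EigenIndex.bot.inj) fun n hn =>
      D.bot_mem_of_le (Nat.lt_succ_iff.1 hn) hm]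
    exact Nat.lt_succ_of_le (D'.card_initial_le _ _)
  · intro i hi
    obtain ⟨n, hn, hni⟩ := D.mem_initial.1 hi
    rw [← hni]
    exact neg_le_neg (D.val_bot_le (Nat.lt_succ_iff.1 hn) hm)
  · intro l hl
    exact neg_le_neg (hc l l.2 fun n hn h => hl (D'.mem_initial.2 ⟨n, hn, h⟩))

theorem extVal_top_le_add (hE : ¬ FiniteDimensional 𝕜 E) (hH : IsSelfAdjoint H)
    (hH' : IsSelfAdjoint H') (D : EigenSystem H) (D' : EigenSystem H') (m : ℕ) :
    D.extVal (EigenIndex.top m) ≤ D'.extVal (EigenIndex.top m) + ‖H' - H‖ := by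
  by_cases hm : EigenIndex.top m ∈ D.indices
  · rw [D.extVal_of_mem hm]
    refine val_top_le_add hH hH' D D' hm fun l hl hlm => ?_
    cases l with
    | top n =>
      have hmn : m ≤ n := not_lt.1 fun h => hlm n h rfl
      rw [D'.extVal_of_mem (D'.top_mem_of_le hmn hl)]
      exact D'.val_top_le hmn hl
    | ker n => exact (D'.ker_eq_zero hE n hl).trans_le (D'.extVal_top_nonneg hE m)
    | bot n => exact (D'.bot_nonpos hE n hl).trans (D'.extVal_top_nonneg hE m)
  · rw [D.extVal_of_notMem hm]
    have := D'.extVal_top_nonneg hE m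
    positivity

theorem extVal_bot_le_add (hE : ¬ FiniteDimensional 𝕜 E) (hH : IsSelfAdjoint H)
    (hH' : IsSelfAdjoint H') (D : EigenSystem H) (D' : EigenSystem H') (m : ℕ) :
    D'.extVal (EigenIndex.bot m) ≤ D.extVal (EigenIndex.bot m) + ‖H' - H‖ := by
  by_cases hm : EigenIndex.bot m ∈ D.indices
  · rw [D.extVal_of_mem hm]
    refine le_val_bot_add hH hH' D D' hm fun l hl hlm => ?_
    cases l with
    | bot n =>
      have hmn : m ≤ n := not_lt.1 fun h => hlm n h rfl
      rw [D'.extVal_of_mem (D'.bot_mem_of_le hmn hl)]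
      exact D'.val_bot_le hmn hl
    | ker n => exact (D'.extVal_bot_nonpos hE m).trans (D'.ker_eq_zero hE n hl).ge
    | top n => exact (D'.extVal_bot_nonpos hE m).trans (D'.top_nonneg hE n hl)
  · rw [D.extVal_of_notMem hm]
    have := D'.extVal_bot_nonpos hE m
    linarith [norm_nonneg (H' - H)]

/-- Weyl's inequality in infinite dimension. -/
theorem abs_extVal_sub_le (hE : ¬ FiniteDimensional 𝕜 E) (hH : IsSelfAdjoint H)
    (hH' : IsSelfAdjoint H') (D : EigenSystem H) (D' : EigenSystem H') (i : EigenIndex) :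
    |D'.extVal i - D.extVal i| ≤ ‖H' - H‖ := by
  have hsymm := norm_sub_rev H H'
  rw [abs_le]
  cases i with
  | top m =>
    have h1 := extVal_top_le_add hE hH hH' D D' m
    have h2 := extVal_top_le_add hE hH' hH D' D m
    constructor <;> linarith
  | ker m => simp [D.extVal_ker hE, D'.extVal_ker hE]
  | bot m =>
    have h1 := extVal_bot_le_add hE hH hH' D D' m
    have h2 := extVal_bot_le_add hE hH' hH D' D m
    constructor <;> linarith

/-- In finite dimension the index sets are determined by the dimension. -/
theorem indices_subset_of_finiteDimensional (hE : FiniteDimensional 𝕜 E) (hH : IsSelfAdjoint H)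
    (hH' : IsSelfAdjoint H') (D : EigenSystem H) (D' : EigenSystem H') :
    D.indices ⊆ D'.indices := by
  intro i hi
  obtain ⟨m, rfl⟩ := D.top_of_finite hE i hi
  by_contra hm
  -- no index of `D'` lies beyond the first `m`, so the min-max comparison holds for every bound
  have h := val_top_le_add hH hH' D D' hi (c := D.val (EigenIndex.top m) - ‖H' - H‖ - 1)
    fun l hl hlm => by
      obtain ⟨n, rfl⟩ := D'.top_of_finite hE l hl
      exact absurd (D'.top_mem_of_le (not_lt.1 fun h => hlm n h rfl) hl) hm
  linarith

theorem val_le_add_of_finiteDimensional (hE : FiniteDimensional 𝕜 E) (hH : IsSelfAdjoint H)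
    (hH' : IsSelfAdjoint H') (D : EigenSystem H) (D' : EigenSystem H') {i : EigenIndex}
    (hi : i ∈ D.indices) : D.val i ≤ D'.val i + ‖H' - H‖ := by
  obtain ⟨m, rfl⟩ := D.top_of_finite hE i hi
  refine val_top_le_add hH hH' D D' hi fun l hl hlm => ?_
  obtain ⟨n, rfl⟩ := D'.top_of_finite hE l hl
  exact D'.val_top_le (not_lt.1 fun h => hlm n h rfl) hl

end Weyl

/-! ### Separation of the perturbed eigenvalues -/

theorem gap_le {𝕜 : Type*} [RCLike 𝕜] {E : Type*} [NormedAddCommGroup E] [InnerProductSpace 𝕜 E]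
    {T : E →L[𝕜] E} (D : EigenSystem T) {J : Finset EigenIndex} {k l : EigenIndex} (hk : k ∈ J)
    (hl : l ∈ D.indices) (hlJ : l ∉ J) : D.gap J ≤ |D.val l - D.val k| := by
  rw [abs_sub_comm]
  refine csInf_le ⟨0, ?_⟩ ⟨k, hk, l, hl, hlJ, rfl⟩
  rintro _ ⟨k, -, l, -, -, rfl⟩
  exact abs_nonneg _

/-- The perturbed eigenvalues at the indices in `J` exist and are close to the unperturbed ones,
and the other perturbed eigenvalues stay away from them. -/
theorem perturbed_eigenvalues {𝕜 : Type*} [RCLike 𝕜] {E : Type*} [NormedAddCommGroup E]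
    [InnerProductSpace 𝕜 E] [CompleteSpace E] {H H' : E →L[𝕜] E} (hHc : IsCompactOperator H)
    (hH : IsSelfAdjoint H) (hH' : IsSelfAdjoint H') (D : EigenSystem H) (D' : EigenSystem H')
    {J : Finset EigenIndex} (hJ : (J : Set EigenIndex) ⊆ D.indices) {γ : ℝ}
    (hγ : ‖H' - H‖ < γ) (hgap : ∀ k ∈ J, ∀ l ∈ D.indices, l ∉ J → γ ≤ |D.val l - D.val k|) :
    (J : Set EigenIndex) ⊆ D'.indices ∧ (∀ k ∈ J, |D'.val k - D.val k| ≤ ‖H' - H‖) ∧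
      ∀ k ∈ J, ∀ l ∈ D'.indices, l ∉ J → γ - ‖H' - H‖ ≤ |D'.val l - D.val k| := by
  by_cases hE : FiniteDimensional 𝕜 E
  · have hsub := indices_subset_of_finiteDimensional hE hH hH' D D'
    have hsub' := indices_subset_of_finiteDimensional hE hH' hH D' D
    have hval : ∀ i ∈ D.indices, |D'.val i - D.val i| ≤ ‖H' - H‖ := fun i hi => by
      have h1 := val_le_add_of_finiteDimensional hE hH hH' D D' hi
      have h2 := val_le_add_of_finiteDimensional hE hH' hH D' D (hsub hi)
      rw [norm_sub_rev] at h2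
      rw [abs_le]
      constructor <;> linarith
    refine ⟨hJ.trans hsub, fun k hk => hval k (hJ hk), fun k hk l hl hlJ => ?_⟩
    have h1 := hgap k hk l (hsub' hl) hlJ
    have h2 := hval l (hsub' hl)
    have h3 := abs_sub_le (D.val l) (D'.val l) (D.val k)
    rw [abs_sub_comm (D.val l) (D'.val l)] at h3
    linarith
  · have hval := abs_extVal_sub_le hE hH hH' D D'
    have hzero : ∀ k ∈ J, γ ≤ |D.val k| := fun k hk => D.le_abs_val_of_gap hE hHc (hgap k hk)
    have hJ' : (J : Set EigenIndex) ⊆ D'.indices := fun k hk => by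
      by_contra hk'
      have h1 := hval k
      rw [D'.extVal_of_notMem hk', D.extVal_of_mem (hJ hk), zero_sub, abs_neg] at h1
      exact absurd ((hzero k hk).trans h1) (not_le.2 hγ)
    refine ⟨hJ', fun k hk => ?_, fun k hk l hl hlJ => ?_⟩
    · simpa [D.extVal_of_mem (hJ hk), D'.extVal_of_mem (hJ' hk)] using hval k
    · have h1 : γ ≤ |D.extVal l - D.val k| := by
        by_cases hlD : l ∈ D.indices
        · rw [D.extVal_of_mem hlD]; exact hgap k hk l hlD hlJ
        · rw [D.extVal_of_notMem hlD, zero_sub, abs_neg]; exact hzero k hk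
      have h2 := hval l
      rw [D'.extVal_of_mem hl] at h2
      have h3 := abs_sub_le (D.extVal l) (D'.val l) (D.val k)
      rw [abs_sub_comm (D.extVal l) (D'.val l)] at h3
      linarith

theorem numDistinct_eq_card_image {𝕜 : Type*} [RCLike 𝕜] {E : Type*} [NormedAddCommGroup E]
    [InnerProductSpace 𝕜 E] {T : E →L[𝕜] E} (D : EigenSystem T) (J : Finset EigenIndex) :
    D.numDistinct J = (J.image D.val).card := by
  rw [numDistinct, ← Finset.coe_image, Set.ncard_coe_finset]

end EigenSystem

theorem mainTheorem1 {𝕜 : Type*} [RCLike 𝕜] {E : Type*} [NormedAddCommGroup E]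
    [InnerProductSpace 𝕜 E] [CompleteSpace E] [TopologicalSpace.SeparableSpace E]
    (H H' : E →L[𝕜] E)
    (hHc : IsCompactOperator H) (hHs : IsSelfAdjoint H)
    (hHc' : IsCompactOperator H') (hHs' : IsSelfAdjoint H')
    (D : EigenSystem H) (D' : EigenSystem H')
    (J : Finset EigenIndex) (hJ : (J : Set EigenIndex) ⊆ D.indices)
    (hgap : 0 < D.gap J)
    (hclose : ‖H' - H‖ / D.gap J < 1 / 4) :
    (J : Set EigenIndex) ⊆ D'.indices ∧
    (∀ k ∈ J, Summable fun l : {l : EigenIndex // l ∈ D.indices ∧ l ∉ J} =>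
      D.firstOrderSummand (H' - H) k l) ∧
    ‖D'.P J - D.P J - D.firstOrder (H' - H) J‖ ≤
      8 * (D.numDistinct J : ℝ) * (‖H' - H‖ / D.gap J) ^ 2 := by
  have hlt : ‖H' - H‖ < D.gap J := by
    rw [div_lt_iff₀ hgap] at hclose
    linarith
  have hgap' : ∀ k ∈ J, ∀ l ∈ D.indices, l ∉ J → D.gap J ≤ |D.val l - D.val k| :=
    fun k hk l hl hlJ => D.gap_le hk hl hlJ
  obtain ⟨hJ', hval, hsep⟩ :=
    EigenSystem.perturbed_eigenvalues hHc hHs hHs' D D' hJ hlt hgap'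
  refine ⟨hJ', fun k hk => (D.hasSum_firstOrderSummand (hHs'.sub hHs) hgap (hgap' k hk)).summable,
    ?_⟩
  rw [D.numDistinct_eq_card_image]
  exact EigenSystem.norm_P_sub_P_sub_firstOrder_le hHs hHs' D D' hJ hJ' hgap hclose hgap' hsep hval
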